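/- An infinite word $\mathbf w=w_0w_1w_2\cdots$ over the alphabet $\{0,1\}$ is \emph{Sturmian} if for every $n\ge 0$ it has exactly $n+1$ distinct factors of length $n$. For $\alpha,\rho\in[0,1)$, the lower (resp. upper) mechanical word $\mathbf s_{\alpha,\rho}$ (resp. $\mathbf s'_{\alpha,\rho}$) of slope $\alpha$ and intercept $\rho$ is the infinite word whose $n$-th letter, $n\ge 0$, is $0$ if $\{n\alpha+\rho\}<1-\alpha$ (resp. if $0<\{n\alpha+\rho\}\le 1-\alpha$) and $1$ otherwise, where $\{x\}=x-\lfloor x\rfloor$. A Sturmian word has slope $\alpha$ if it is a lower or upper mechanical word of slope $\alpha$, for some intercept. The characteristic word of slope $\alpha$ is $\mathbf c=\mathbf s_{\alpha,\alpha}$. Two finite words are Abelian equivalent if one is obtained from the other by permuting its letters. Proposition. Let $\mathbf w,\mathbf w'$ be Sturmian words of the same slope $\alpha$, and let $\mathbf c=\mathbf s_{\alpha,\alpha}$ be the characteristic word of slope $\alpha$. If $\{\mathbf w,\mathbf w'\}\ne\{0\mathbf c,1\mathbf c\}$, then $\mathbf w$ and $\mathbf w'$ are Abelian comparable, that is, they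 have arbitrarily long Abelian equivalent prefixes: for every $N$ there is $n\ge N$ such that the prefixes of length $n$ of $\mathbf w$ and of $\mathbf w'$ are Abelian equivalent. -/

import Mathlib

namespace SturmianWords

/-- Infinite words over the binary alphabet `{0, 1}`, indexed from `0`. -/
abbrev InfWord : Type := ℕ → Fin 2

/-- The factor of length `n` of `w` that occurs at position `i`. -/
def factorAt (w : InfWord) (i n : ℕ) : List (Fin 2) :=
  (List.range n).map (fun j => w (i + j))

/-- The set of factors of length `n` of `w`. -/
def factors (w : InfWord) (n : ℕ) : Set (List (Fin 2)) :=
  {u | ∃ i : ℕ, u = factorAt w i n}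

/-- The prefix of length `n` of `w`. -/
def pref (w : InfWord) (n : ℕ) : List (Fin 2) :=
  factorAt w 0 n

/-- `w` is Sturmian: it has exactly `n + 1` distinct factors of each length `n`. -/
def IsSturmian (w : InfWord) : Prop :=
  ∀ n : ℕ, (factors w n).ncard = n + 1

open Classical in
/-- The lower mechanical word of slope `α` and intercept `ρ`: the `n`-th letter is `0` if
`{nα + ρ} < 1 - α`, and `1` otherwise. -/
noncomputable def lowerMechanical (α ρ : ℝ) : InfWord := fun n =>
  if Int.fract ((n : ℝ) * α + ρ) < 1 - α then 0 else 1

open Classical in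
/-- The upper mechanical word of slope `α` and intercept `ρ`: the `n`-th letter is `0` if
`0 < {nα + ρ} ≤ 1 - α`, and `1` otherwise. -/
noncomputable def upperMechanical (α ρ : ℝ) : InfWord := fun n =>
  if 0 < Int.fract ((n : ℝ) * α + ρ) ∧ Int.fract ((n : ℝ) * α + ρ) ≤ 1 - α then 0 else 1

/-- `w` has slope `α`: it is a (lower or upper) mechanical word of slope `α ∈ [0, 1)`, for some
intercept in `[0, 1)`. -/
def HasSlope (w : InfWord) (α : ℝ) : Prop :=
  0 ≤ α ∧ α < 1 ∧
    ∃ ρ : ℝ, 0 ≤ ρ ∧ ρ < 1 ∧ (w = lowerMechanical α ρ ∨ w = upperMechanical α ρ)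

/-- The characteristic word of slope `α`. -/
noncomputable def characteristicWord (α : ℝ) : InfWord :=
  lowerMechanical α α

/-- The infinite word `a w`, obtained by writing the letter `a` in front of `w`. -/
def prepend (a : Fin 2) (w : InfWord) : InfWord
  | 0 => a
  | n + 1 => w n

/-- Two finite words are Abelian equivalent if one is an anagram of the other. -/
def AbelianEquivalent (u v : List (Fin 2)) : Prop :=
  u.Perm v

/-- Two infinite words are Abelian comparable if they have arbitrarily long Abelian equivalent
prefixes. -/
def AbelianComparable (w w' : InfWord) : Prop :=
  ∀ N : ℕ, ∃ n : ℕ, N ≤ n ∧ AbelianEquivalent (pref w n) (pref w' n)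

end SturmianWords

namespace SturmianWords

open Filter Topology

/-! ### Multiples of an irrational number modulo one -/

/-- The positive multiples of an irrational number enter every open interval modulo one
infinitely often. -/
theorem exists_nat_mul_eq_add_int {α : ℝ} (hα : Irrational α) {a b : ℝ} (hab : a < b) (N : ℕ) :
    ∃ n : ℕ, N ≤ n ∧ ∃ y ∈ Set.Ioo a b, ∃ k : ℤ, (n : ℝ) * α = y + k := by
  have : Fact ((0 : ℝ) < 1) := ⟨one_pos⟩
  have hd : DenseRange (· • (α : AddCircle (1 : ℝ)) : ℤ → AddCircle (1 : ℝ)) :=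
    AddCircle.denseRange_zsmul_coe_iff.2 (by simpa using hα)
  obtain ⟨x, hx⟩ := exists_between hab
  have hcl : MapClusterPt (x : AddCircle (1 : ℝ)) atTop
      (· • (α : AddCircle (1 : ℝ)) : ℕ → AddCircle (1 : ℝ)) :=
    ((mapClusterPt_atTop_nsmul_tfae _ _).out 3 0).1 (hd _)
  have hopen : ((↑) '' Set.Ioo a b : Set (AddCircle (1 : ℝ))) ∈ 𝓝 (x : AddCircle (1 : ℝ)) :=
    (QuotientAddGroup.isOpenMap_coe _ isOpen_Ioo).mem_nhds (Set.mem_image_of_mem _ hx)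
  obtain ⟨n, hn, y, hy, hyn⟩ := frequently_atTop.1 (hcl.frequently hopen) N
  refine ⟨n, hn, y, hy, ?_⟩
  have h : ((y : ℝ) : AddCircle (1 : ℝ)) = (((n : ℝ) * α : ℝ) : AddCircle (1 : ℝ)) := by
    rw [hyn, ← nsmul_eq_mul]; rfl
  rw [QuotientAddGroup.eq, AddSubgroup.mem_zmultiples_iff] at h
  obtain ⟨k, hk⟩ := h
  refine ⟨k, ?_⟩
  simp only [zsmul_eq_mul, mul_one] at hk
  linarith

/-! ### Prefixes and their number of ones -/

theorem pref_succ (w : InfWord) (n : ℕ) : pref w (n + 1) = pref w n ++ [w n] := by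
  simp [pref, factorAt, List.range_succ]

theorem length_pref (w : InfWord) (n : ℕ) : (pref w n).length = n := by
  simp [pref, factorAt]

theorem count_zero_add_count_one (u : List (Fin 2)) : u.count 0 + u.count 1 = u.length := by
  induction u with
  | nil => rfl
  | cons x u ih =>
    have hx : x = 0 ∨ x = 1 := by omega
    rcases hx with rfl | rfl <;> simp <;> omega

/-- Binary words of the same length are Abelian equivalent once they have equally many ones. -/
theorem abelianEquivalent_of_count_one_eq {u v : List (Fin 2)} (hl : u.length = v.length)
    (h : u.count 1 = v.count 1) : AbelianEquivalent u v := by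
  refine List.perm_iff_count.2 fun x => ?_
  have hu := count_zero_add_count_one u
  have hv := count_zero_add_count_one v
  have hx : x = 0 ∨ x = 1 := by omega
  rcases hx with rfl | rfl <;> omega

/-- If the letters of `w` are the increments of `f`, the number of ones in a prefix is an increment
of `f`. -/
theorem count_one_pref_eq_sub (w : InfWord) (f : ℕ → ℤ)
    (h : ∀ n, f (n + 1) - f n = if w n = 1 then 1 else 0) (n : ℕ) :
    ((pref w n).count 1 : ℤ) = f n - f 0 := by
  induction n with
  | zero => simp [pref, factorAt]
  | succ n ih =>
    have := h n
    rw [pref_succ, List.count_append, List.count_singleton]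
    split_ifs at this with hw <;> simp [hw] <;> linarith

/-! ### Mechanical words -/

theorem floor_add_sub_floor {α : ℝ} (h0 : 0 ≤ α) (h1 : α < 1) (x : ℝ) :
    ⌊x + α⌋ - ⌊x⌋ = if Int.fract x < 1 - α then 0 else 1 := by
  have hx := Int.floor_add_fract x
  have hf := Int.fract_nonneg x
  have hf' := Int.fract_lt_one x
  split_ifs with h
  · rw [sub_eq_zero, Int.floor_eq_iff]
    constructor <;> linarith
  · rw [sub_eq_iff_eq_add, Int.floor_eq_iff]
    push_cast
    constructor <;> linarith

theorem ceil_add_sub_ceil {α : ℝ} (h0 : 0 < α) (h1 : α < 1) (x : ℝ) :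
    ⌈x + α⌉ - ⌈x⌉ = if 0 < Int.fract x ∧ Int.fract x ≤ 1 - α then 0 else 1 := by
  have hx := Int.floor_add_fract x
  have hf := Int.fract_nonneg x
  have hf' := Int.fract_lt_one x
  rcases hf.eq_or_lt with h | h
  · have hc : ⌈x⌉ = ⌊x⌋ := by rw [Int.ceil_eq_iff]; constructor <;> linarith
    rw [← h, if_neg (by simp), hc, sub_eq_iff_eq_add, Int.ceil_eq_iff]
    push_cast
    constructor <;> linarith
  · have hc : ⌈x⌉ = ⌊x⌋ + 1 := by
      rw [Int.ceil_eq_iff]; push_cast; constructor <;> linarith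
    rw [hc, sub_eq_iff_eq_add, Int.ceil_eq_iff]
    split_ifs with h2
    · push_cast
      constructor <;> linarith [h2.2]
    · have : 1 - α < Int.fract x := not_le.1 fun h3 => h2 ⟨h, h3⟩
      push_cast
      constructor <;> linarith

theorem count_one_pref_lowerMechanical {α : ℝ} (h0 : 0 ≤ α) (h1 : α < 1) (ρ : ℝ) (n : ℕ) :
    ((pref (lowerMechanical α ρ) n).count 1 : ℤ) = ⌊(n : ℝ) * α + ρ⌋ - ⌊ρ⌋ := by
  rw [count_one_pref_eq_sub _ fun n : ℕ => ⌊(n : ℝ) * α + ρ⌋]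
  · simp
  · intro n
    have := floor_add_sub_floor h0 h1 ((n : ℝ) * α + ρ)
    rw [show ((n + 1 : ℕ) : ℝ) * α + ρ = n * α + ρ + α by push_cast; ring, this]
    unfold lowerMechanical
    split_ifs <;> simp_all

theorem count_one_pref_upperMechanical {α : ℝ} (h0 : 0 < α) (h1 : α < 1) (ρ : ℝ) (n : ℕ) :
    ((pref (upperMechanical α ρ) n).count 1 : ℤ) = ⌈(n : ℝ) * α + ρ⌉ - ⌈ρ⌉ := by
  rw [count_one_pref_eq_sub _ fun n : ℕ => ⌈(n : ℝ) * α + ρ⌉]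
  · simp
  · intro n
    have := ceil_add_sub_ceil h0 h1 ((n : ℝ) * α + ρ)
    rw [show ((n + 1 : ℕ) : ℝ) * α + ρ = n * α + ρ + α by push_cast; ring, this]
    unfold upperMechanical
    split_ifs <;> simp_all

theorem lowerMechanical_zero {α : ℝ} (h1 : α < 1) :
    lowerMechanical α 0 = prepend 0 (characteristicWord α) := by
  funext n
  cases n with
  | zero => simp [lowerMechanical, prepend, h1]
  | succ n => simp [lowerMechanical, prepend, characteristicWord, add_mul]

theorem upperMechanical_zero {α : ℝ} (hα : Irrational α) :
    upperMechanical α 0 = prepend 1 (characteristicWord α) := by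
  funext n
  cases n with
  | zero => simp [upperMechanical, prepend]
  | succ n =>
    have hirr : Irrational (((n + 1 : ℕ) : ℝ) * α) := hα.natCast_mul n.succ_ne_zero
    have hpos : 0 < Int.fract (((n + 1 : ℕ) : ℝ) * α) :=
      Int.fract_pos.2 fun h => hirr.ne_int _ h
    have hne : Int.fract (((n + 1 : ℕ) : ℝ) * α) ≠ 1 - α := by
      intro h
      refine (hα.natCast_mul (n + 1).succ_ne_zero).ne_int
        (⌊((n + 1 : ℕ) : ℝ) * α⌋ + 1) ?_
      have := Int.floor_add_fract (((n + 1 : ℕ) : ℝ) * α)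
      push_cast at *
      linarith
    have hc : ((n : ℝ) * α + α) = ((n + 1 : ℕ) : ℝ) * α := by push_cast; ring
    simp only [upperMechanical, prepend, characteristicWord, lowerMechanical, add_zero, hc, hpos,
      true_and, hne.le_iff_lt]

/-! ### Sturmian words have irrational slope -/

theorem not_isSturmian_of_periodic {w : InfWord} {q : ℕ} (hq : 0 < q)
    (h : Function.Periodic w q) : ¬ IsSturmian w := by
  intro hw
  have hsub : factors w q ⊆ ((Finset.range q).image fun i => factorAt w i q :
      Finset (List (Fin 2))) := by
    rintro u ⟨i, rfl⟩
    rw [Finset.coe_image]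
    refine ⟨i % q, by simpa using Nat.mod_lt i hq, ?_⟩
    simp only [factorAt]
    refine List.map_congr_left fun j _ => ?_
    rw [← h.map_mod_nat (i % q + j), ← h.map_mod_nat (i + j), Nat.mod_add_mod]
  have h1 := Set.ncard_le_ncard hsub (Finset.finite_toSet _)
  rw [Set.ncard_coe_finset, hw q] at h1
  have h2 := (h1.trans Finset.card_image_le)
  simp at h2

theorem irrational_of_isSturmian_of_hasSlope {w : InfWord} {α : ℝ} (hw : IsSturmian w)
    (hα : HasSlope w α) : Irrational α := by
  rintro ⟨r, rfl⟩
  have key : ∀ (ρ : ℝ) (n : ℕ), Int.fract (((n + r.den : ℕ) : ℝ) * (r : ℝ) + ρ) =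
      Int.fract ((n : ℝ) * (r : ℝ) + ρ) := by
    intro ρ n
    have : (r.den : ℝ) * (r : ℝ) = r.num := by exact_mod_cast Rat.den_mul_eq_num r
    rw [show ((n + r.den : ℕ) : ℝ) * (r : ℝ) + ρ = n * (r : ℝ) + ρ + (r.num : ℤ) by
      rw [← this]; push_cast; ring, Int.fract_add_intCast]
  refine not_isSturmian_of_periodic r.den_pos (fun n => ?_) hw
  obtain ⟨-, -, ρ, -, -, rfl | rfl⟩ := hα
  · simp only [lowerMechanical, key]
  · simp only [upperMechanical, key]

/-! ### Abelian comparability -/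

/-- Every word of slope `α` other than `upperMechanical α 0` has `k` ones in its prefix of length
`n` when `n α - k` is positive and small enough. -/
theorem count_one_pref_of_small {α ρ : ℝ} (h0 : 0 < α) (h1 : α < 1) (hρ : 0 ≤ ρ) (hρ1 : ρ < 1)
    {w : InfWord} (hw : w = lowerMechanical α ρ ∨ w = upperMechanical α ρ ∧ 0 < ρ)
    {n : ℕ} {y : ℝ} {k : ℤ} (hy : 0 < y) (hy1 : y < 1 - ρ) (h : (n : ℝ) * α = y + k) :
    ((pref w n).count 1 : ℤ) = k := by
  rcases hw with rfl | ⟨rfl, hρ0⟩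
  · rw [count_one_pref_lowerMechanical h0.le h1, h, Int.floor_eq_zero_iff.2 ⟨hρ, hρ1⟩, sub_zero,
      Int.floor_eq_iff]
    constructor <;> linarith
  · have : ⌈ρ⌉ = 1 := by rw [Int.ceil_eq_iff]; push_cast; constructor <;> linarith
    rw [count_one_pref_upperMechanical h0 h1, h, this, sub_eq_iff_eq_add, Int.ceil_eq_iff]
    push_cast
    constructor <;> linarith

/-- Every word of slope `α` other than `lowerMechanical α 0` has `k + 1` ones in its prefix of
length `n` when `k + 1 - n α` is positive and small enough. -/
theorem count_one_pref_of_large {α ρ : ℝ} (h0 : 0 < α) (h1 : α < 1) (hρ : 0 ≤ ρ) (hρ1 : ρ < 1)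
    {w : InfWord} (hw : w = lowerMechanical α ρ ∧ 0 < ρ ∨ w = upperMechanical α ρ)
    {n : ℕ} {y : ℝ} {k : ℤ} (hy0 : 0 < y) (hy : 0 < ρ → 1 - ρ < y) (hy1 : y < 1)
    (h : (n : ℝ) * α = y + k) :
    ((pref w n).count 1 : ℤ) = k + 1 := by
  rcases hw with ⟨rfl, hρ0⟩ | rfl
  · have := hy hρ0
    rw [count_one_pref_lowerMechanical h0.le h1, h, Int.floor_eq_zero_iff.2 ⟨hρ, hρ1⟩, sub_zero,
      Int.floor_eq_iff]
    push_cast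
    constructor <;> linarith
  · rw [count_one_pref_upperMechanical h0 h1, h, sub_eq_iff_eq_add, Int.ceil_eq_iff]
    rcases hρ.eq_or_lt with rfl | hρ0
    · simp only [Int.ceil_zero]
      push_cast
      constructor <;> linarith
    · have := hy hρ0
      have : ⌈ρ⌉ = 1 := by rw [Int.ceil_eq_iff]; push_cast; constructor <;> linarith
      rw [this]
      push_cast
      constructor <;> linarith

theorem abelianComparable_of_small {α ρ ρ' : ℝ} (hα : Irrational α) (h0 : 0 < α) (h1 : α < 1)
    (hρ : 0 ≤ ρ) (hρ1 : ρ < 1) (hρ' : 0 ≤ ρ') (hρ1' : ρ' < 1) {w w' : InfWord}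
    (hw : w = lowerMechanical α ρ ∨ w = upperMechanical α ρ ∧ 0 < ρ)
    (hw' : w' = lowerMechanical α ρ' ∨ w' = upperMechanical α ρ' ∧ 0 < ρ') :
    AbelianComparable w w' := by
  intro N
  obtain ⟨n, hn, y, ⟨hy0, hy1⟩, k, hk⟩ := exists_nat_mul_eq_add_int hα
    (lt_min (sub_pos.2 hρ1) (sub_pos.2 hρ1')) N
  refine ⟨n, hn, abelianEquivalent_of_count_one_eq (by simp [length_pref]) ?_⟩
  have e := count_one_pref_of_small h0 h1 hρ hρ1 hw hy0 (hy1.trans_le (min_le_left _ _)) hk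
  have e' := count_one_pref_of_small h0 h1 hρ' hρ1' hw' hy0 (hy1.trans_le (min_le_right _ _)) hk
  exact_mod_cast e.trans e'.symm

theorem abelianComparable_of_large {α ρ ρ' : ℝ} (hα : Irrational α) (h0 : 0 < α) (h1 : α < 1)
    (hρ : 0 ≤ ρ) (hρ1 : ρ < 1) (hρ' : 0 ≤ ρ') (hρ1' : ρ' < 1) {w w' : InfWord}
    (hw : w = lowerMechanical α ρ ∧ 0 < ρ ∨ w = upperMechanical α ρ)
    (hw' : w' = lowerMechanical α ρ' ∧ 0 < ρ' ∨ w' = upperMechanical α ρ') :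
    AbelianComparable w w' := by
  have bound : ∀ r : ℝ, 0 ≤ r → r < 1 → ∃ a : ℝ, 0 ≤ a ∧ a < 1 ∧ (0 < r → 1 - r ≤ a) := by
    intro r hr hr1
    rcases hr.eq_or_lt with rfl | h
    · exact ⟨0, le_rfl, one_pos, fun h => absurd h (lt_irrefl _)⟩
    · exact ⟨1 - r, by linarith, by linarith, fun _ => le_rfl⟩
  obtain ⟨a, ha, ha1, har⟩ := bound ρ hρ hρ1
  obtain ⟨b, hb, hb1, hbr⟩ := bound ρ' hρ' hρ1'
  intro N
  obtain ⟨n, hn, y, ⟨hy0, hy1⟩, k, hk⟩ := exists_nat_mul_eq_add_int hα (max_lt ha1 hb1) N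
  obtain ⟨hay, hby⟩ := max_lt_iff.1 hy0
  refine ⟨n, hn, abelianEquivalent_of_count_one_eq (by simp [length_pref]) ?_⟩
  have e := count_one_pref_of_large h0 h1 hρ hρ1 hw (ha.trans_lt hay)
    (fun h => (har h).trans_lt hay) hy1 hk
  have e' := count_one_pref_of_large h0 h1 hρ' hρ1' hw' (ha.trans_lt hay)
    (fun h => (hbr h).trans_lt hby) hy1 hk
  exact_mod_cast e.trans e'.symm

end SturmianWords

open SturmianWords in
theorem mainTheorem6 (α : ℝ) (w w' : SturmianWords.InfWord)
    (hw : SturmianWords.IsSturmian w) (hw' : SturmianWords.IsSturmian w')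
    (hα : SturmianWords.HasSlope w α) (hα' : SturmianWords.HasSlope w' α)
    (hne : ({w, w'} : Set SturmianWords.InfWord) ≠
      {SturmianWords.prepend 0 (SturmianWords.characteristicWord α),
        SturmianWords.prepend 1 (SturmianWords.characteristicWord α)}) :
    SturmianWords.AbelianComparable w w' := by
  have hirr := irrational_of_isSturmian_of_hasSlope hw hα
  obtain ⟨h0, h1, ρ, hρ, hρ1, hwρ⟩ := hα
  obtain ⟨-, -, ρ', hρ', hρ1', hwρ'⟩ := hα'
  have hpos : 0 < α := h0.lt_of_ne hirr.ne_zero.symm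
  rw [← lowerMechanical_zero h1, ← upperMechanical_zero hirr] at hne
  by_cases hs : (w = lowerMechanical α ρ ∨ w = upperMechanical α ρ ∧ 0 < ρ) ∧
      (w' = lowerMechanical α ρ' ∨ w' = upperMechanical α ρ' ∧ 0 < ρ')
  · exact abelianComparable_of_small hirr hpos h1 hρ hρ1 hρ' hρ1' hs.1 hs.2
  · refine abelianComparable_of_large hirr hpos h1 hρ hρ1 hρ' hρ1' ?_ ?_
    all_goals
      rcases hρ.eq_or_lt with rfl | hρ0 <;> rcases hρ'.eq_or_lt with rfl | hρ0' <;>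
      rcases hwρ with rfl | rfl <;> rcases hwρ' with rfl | rfl <;>
      simp_all [Set.pair_comm]
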